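/- Let $H$ be a Hermitian operator on a finite-dimensional Hilbert space (e.g. an $n$-qubit Hamiltonian), $\beta\in\mathbb{R}$, and let $\rho_\beta=e^{-\beta H}/\operatorname{tr}(e^{-\beta H})$. For $s\in[0,1]$ put $\langle A,B\rangle_s=\operatorname{tr}(A^\dagger\rho_\beta^{1-s}B\rho_\beta^{s})$. A linear map $\mathcal T$ on operators satisfies $s$-detailed balance if its Hilbert–Schmidt dual $\mathcal T^\dagger$ is self-adjoint with respect to $\langle\cdot,\cdot\rangle_s$. Let $\mathcal N$ be a quantum channel (completely positive trace-preserving map) that satisfies $s$-detailed balance, has $\rho_\beta$ as its unique fixed state and has spectrum contained in $[0,1]$. Let $\mathrm{gap}(\mathcal N)=1-\lambda_2$, where $\lambda_2$ is the largest eigenvalue of $\mathcal N$ other than the (simple) eigenvalue $1$, and let $t_{mix}(\eta)$ be the least $t\in\mathbb N$ such that $\|\mathcal N^t(\sigma)-\rho_\beta\|_1\le\eta$ for all states $\sigma$. Let $\mathcal M(X)=\sum_u O_uXO_u^\dagger$ be a measurement channel with finitely many Kraus operators labelled by real outcomes $u$, $\sum_uO_u^\dagger O_u=I$. Put $$v=\mathbb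 E_{\rho_\beta}(\mathcal M)=\sum_u u\,\operatorname{tr}(O_u\rho_\beta O_u^\dagger),\qquad \mathbb V_{\rho_\beta}(\mathcal M)=\sum_u|u-v|^2\operatorname{tr}(O_u\rho_\beta O_u^\dagger),$$ $$\mathrm{Cov}_{\rho_\beta}(\mathcal M)=\sum_{x,y}(x-v)(y-v)\operatorname{tr}(O_yO_x\rho_\beta O_x^\dagger O_y^\dagger),\qquad \widehat{\mathcal M}(X)=\sum_u(u-v)\,O_uXO_u^\dagger .$$ Suppose that $\mathcal M$ and $\widehat{\mathcal M}$ both satisfy $s$-detailed balance. Let $\rho$ be an arbitrary initial state, $\epsilon,\eta>0$, and let $K\ge1$ be an integer with $$K\;\ge\;\frac{2\,\mathbb V_{\rho_\beta}(\mathcal M)}{\epsilon^2\eta}\left(\frac{p}{\mathrm{gap}(\mathcal N)}+\frac12\right),\qquad p=\frac{\mathrm{Cov}_{\rho_\beta}(\mathcal M)}{\mathbb V_{\rho_\beta}(\mathcal M)}$$ (with $p=0$ if $\mathbb V_{\rho_\beta}(\mathcal M)=0$). Apply $\mathcal N$ to $\rho$ for $T_{burn}=t_{mix}(\eta)$ times;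 then, for $t=1,\dots,K$, apply $\mathcal M$ and record its outcome $e_t$, apply $\mathcal N$, and apply $\mathcal M$ again, discarding the outcome of this second measurement. Then $$\Pr_\rho\left(\left|\frac1K\sum_{t=1}^Ke_t-\mathbb E_{\rho_\beta}(\mathcal M)\right|\ge\epsilon\right)\le 2\eta .$$ -/

import Mathlib

namespace SingleTrajectory

open Matrix
open scoped ComplexOrder

noncomputable section

/-- Linear maps on the space of complex `d × d` matrices. For `n` qubits, `d` has `2 ^ n` elements. -/
abbrev SuperOp (d : Type*) [Fintype d] [DecidableEq d] : Type _ :=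
  Module.End ℂ (Matrix d d ℂ)

/-- Quantum states: positive semidefinite matrices of trace one. -/
def IsState {d : Type*} [Fintype d] [DecidableEq d] (ρ : Matrix d d ℂ) : Prop :=
  ρ.PosSemidef ∧ ρ.trace = 1

/-- The Gibbs state `exp (-β H) / tr (exp (-β H))`. -/
def gibbs {d : Type*} [Fintype d] [DecidableEq d] (H : Matrix d d ℂ) (β : ℝ) : Matrix d d ℂ :=
  (NormedSpace.exp ((-(β : ℂ)) • H)).trace⁻¹ • NormedSpace.exp ((-(β : ℂ)) • H)

/-- The real power `ρ ^ r` of a Hermitian matrix, by functional calculus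
(used only for the positive definite matrix `gibbs H β`). -/
def matPow {d : Type*} [Fintype d] [DecidableEq d] (ρ : Matrix d d ℂ) (r : ℝ) : Matrix d d ℂ :=
  cfc (fun x : ℝ => x ^ r) ρ

/-- The map `X ↦ O X O†`. -/
def conjBy {d : Type*} [Fintype d] [DecidableEq d] (O : Matrix d d ℂ) : SuperOp d where
  toFun X := O * X * Oᴴ
  map_add' X Y := by rw [mul_add, add_mul]
  map_smul' c X := by simp

/-- Quantum channels (completely positive trace-preserving maps), in Kraus form. -/
def IsChannel {d : Type*} [Fintype d] [DecidableEq d] (T : SuperOp d) : Prop :=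
  ∃ (r : ℕ) (Q : Fin r → Matrix d d ℂ), ∑ u, (Q u)ᴴ * Q u = 1 ∧ T = ∑ u, conjBy (Q u)

/-- The Hilbert–Schmidt inner product `tr (A† B)`. -/
def hsInner {d : Type*} [Fintype d] [DecidableEq d] (A B : Matrix d d ℂ) : ℂ :=
  (Aᴴ * B).trace

/-- The dual map `T†` (Heisenberg picture) with respect to the Hilbert–Schmidt inner product.
Its `(i, j)` entry is `⟨E_ij, T† B⟩ = ⟨T E_ij, B⟩`. -/
def dual {d : Type*} [Fintype d] [DecidableEq d] (T : SuperOp d) : SuperOp d where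
  toFun B := Matrix.of fun i j => hsInner (T (Matrix.single i j 1)) B
  map_add' B C := by
    ext i j
    simp [hsInner, mul_add]
  map_smul' c B := by
    ext i j
    simp [hsInner]

/-- The defining property of the dual map. -/
theorem hsInner_dual {d : Type*} [Fintype d] [DecidableEq d] (T : SuperOp d)
    (A B : Matrix d d ℂ) : hsInner A (dual T B) = hsInner (T A) B := by
  have hA : T A = ∑ i, ∑ j, A i j • T (Matrix.single i j 1) := by
    conv_lhs => rw [Matrix.matrix_eq_sum_single A]
    simp only [map_sum]
    refine Finset.sum_congr rfl fun i _ => Finset.sum_congr rfl fun j _ => ?_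
    rw [← map_smul, Matrix.smul_single, smul_eq_mul, mul_one]
  rw [hA]
  simp only [hsInner, dual, LinearMap.coe_mk, AddHom.coe_mk, Matrix.conjTranspose_sum,
    Matrix.conjTranspose_smul, Finset.sum_mul, Matrix.trace_sum, Matrix.smul_mul,
    Matrix.trace_smul]
  rw [Matrix.trace]
  simp only [Matrix.diag_apply, Matrix.mul_apply, Matrix.conjTranspose_apply, Matrix.of_apply,
    smul_eq_mul]
  rw [Finset.sum_comm]

/-- The weighted inner product `⟨A, B⟩_s = tr (A† ρ^(1-s) B ρ^s)`. -/
def weightedInner {d : Type*} [Fintype d] [DecidableEq d] (s : ℝ) (ρ A B : Matrix d d ℂ) : ℂ :=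
  (Aᴴ * matPow ρ (1 - s) * B * matPow ρ s).trace

/-- `s`-detailed balance of a linear map `T` with respect to `ρ`: the dual map `T†` is
self-adjoint for `⟨·,·⟩_s`. -/
def DetailedBalance {d : Type*} [Fintype d] [DecidableEq d] (s : ℝ) (ρ : Matrix d d ℂ)
    (T : SuperOp d) : Prop :=
  ∀ A B : Matrix d d ℂ, weightedInner s ρ A (dual T B) = weightedInner s ρ (dual T A) B

/-- `ρ` is the unique fixed state of `T`. -/
def UniqueFixedState {d : Type*} [Fintype d] [DecidableEq d] (T : SuperOp d)
    (ρ : Matrix d d ℂ) : Prop :=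
  IsState ρ ∧ T ρ = ρ ∧ ∀ σ, IsState σ → T σ = σ → σ = ρ

/-- The spectral gap of a channel with real spectrum and a unique fixed state: one minus the
largest eigenvalue other than `1` (which is then a simple eigenvalue). -/
def gap {d : Type*} [Fintype d] [DecidableEq d] (T : SuperOp d) : ℝ :=
  1 - sSup {x : ℝ | x ≠ 1 ∧ (x : ℂ) ∈ spectrum ℂ T}

/-- The trace norm: the sum of the singular values. -/
def traceNorm {d : Type*} [Fintype d] [DecidableEq d] (A : Matrix d d ℂ) : ℝ :=
  ∑ i, Real.sqrt ((Matrix.isHermitian_conjTranspose_mul_self A).eigenvalues i)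

/-- The mixing time: the least `t` such that `‖N^t(σ) - ρ‖₁ ≤ ε` for every state `σ`. -/
def mixingTime {d : Type*} [Fintype d] [DecidableEq d] (N : SuperOp d) (ρ : Matrix d d ℂ)
    (ε : ℝ) : ℕ :=
  sInf {t : ℕ | ∀ σ, IsState σ → traceNorm ((N ^ t) σ - ρ) ≤ ε}

/-- A quantum measurement with finitely many Kraus operators `O_u`, each carrying a real
outcome (the outcomes need not be distinct). -/
structure Measurement (d ι : Type*) [Fintype d] [DecidableEq d] [Fintype ι] where
  kraus : ι → Matrix d d ℂ
  outcome : ι → ℝ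
  complete : ∑ u, (kraus u)ᴴ * kraus u = 1

namespace Measurement

variable {d ι : Type*} [Fintype d] [DecidableEq d] [Fintype ι]

/-- The channel `X ↦ ∑ u, O_u X O_u†`, in which the outcome is discarded. -/
def channel (M : Measurement d ι) : SuperOp d :=
  ∑ u, conjBy (M.kraus u)

/-- `𝔼_ρ(M)`. -/
def expectation (M : Measurement d ι) (ρ : Matrix d d ℂ) : ℝ :=
  ∑ u, M.outcome u * (conjBy (M.kraus u) ρ).trace.re

/-- `𝕍_ρ(M)`. -/
def variance (M : Measurement d ι) (ρ : Matrix d d ℂ) : ℝ :=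
  ∑ u, |M.outcome u - M.expectation ρ| ^ 2 * (conjBy (M.kraus u) ρ).trace.re

/-- `Cov_ρ(M)`: correlation of the outcomes of two successive applications of `M`. -/
def covariance (M : Measurement d ι) (ρ : Matrix d d ℂ) : ℝ :=
  ∑ x, ∑ y, (M.outcome x - M.expectation ρ) * (M.outcome y - M.expectation ρ) *
    (conjBy (M.kraus y) (conjBy (M.kraus x) ρ)).trace.re

/-- The weighted map `X ↦ ∑ u, (u - 𝔼_ρ(M)) O_u X O_u†`. -/
def hat (M : Measurement d ι) (ρ : Matrix d d ℂ) : SuperOp d :=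
  ∑ u, ((M.outcome u - M.expectation ρ : ℝ) : ℂ) • conjBy (M.kraus u)

/-- The unnormalized state after the rounds of the sampling stage whose recorded Kraus labels,
in chronological order, are `l`, started from `σ`. One round applies `M`, records its label `u`,
then applies `N` and then `M` again with the outcome of that second measurement discarded. -/
def trajectoryState (M : Measurement d ι) (N : SuperOp d) :
    List ι → Matrix d d ℂ → Matrix d d ℂ
  | [], σ => σ
  | u :: l, σ => trajectoryState M N l (M.channel (N (conjBy (M.kraus u) σ)))

/-- The probability that `K` rounds started from `σ` record the labels `x 0, …, x (K - 1)`. -/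
def trajectoryProb (M : Measurement d ι) (N : SuperOp d) (σ : Matrix d d ℂ) {K : ℕ}
    (x : Fin K → ι) : ℝ :=
  (M.trajectoryState N (List.ofFn x) σ).trace.re

/-- The empirical average `(e_1 + ⋯ + e_K) / K` of the recorded outcomes. -/
def empiricalAverage (M : Measurement d ι) {K : ℕ} (x : Fin K → ι) : ℝ :=
  (∑ t, M.outcome (x t)) / K

open Classical in
/-- The probability that, after `T` burn-in applications of `N` to the initial state `ρ` and `K`
rounds of the sampling stage, the empirical average `X_K` satisfies `|X_K - v| ≥ ε`. -/
def deviationProb (M : Measurement d ι) (N : SuperOp d) (ρ : Matrix d d ℂ) (T K : ℕ)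
    (v ε : ℝ) : ℝ :=
  ∑ x : Fin K → ι with ε ≤ |M.empiricalAverage x - v|, M.trajectoryProb N ((N ^ T) ρ) x

end Measurement

end

end SingleTrajectory

/-!
Conjugating the superoperators by `A ↦ ρ^((1-s)/2) A ρ^(s/2)`, where `ρ` is the stationary state,
turns `s`-detailed balance into symmetry for the Hilbert–Schmidt inner product. The conjugates of
`N` and of the measurement channel `M` are then contractions that fix the vector `√ρ`, and the one
of `N` contracts the complement of `√ρ`, i.e. the traceless directions, by the factor `1 - gap`.
Two recorded outcomes that are `j + 1` rounds apart are separated by `j + 1` applications of `N`,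
so at stationarity their covariance is at most `(1 - gap)^(j+1) Cov`, where `Cov` is the squared
norm of the image of `√ρ` under the conjugate of `M.hat ρ`. Summing the geometric series bounds the
second moment of the sum of the centred outcomes by `K (𝕍 + 2 Cov / gap)`, and Chebyshev's
inequality gives the failure probability `η` at stationarity. Starting instead from the state
reached after the mixing time costs at most its trace distance to `ρ`, which is another `η`.
-/

namespace SingleTrajectory

open Matrix
open scoped ComplexOrder InnerProductSpace

noncomputable section

/-! ### Symmetric operators with a spectral gap -/

section Operators

variable {𝕜 E : Type*} [RCLike 𝕜] [NormedAddCommGroup E] [InnerProductSpace 𝕜 E]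

/-- `T` leaves the subspace `W` invariant and has norm at most `c` there. -/
structure ContractsOn (T : Module.End 𝕜 E) (W : Submodule 𝕜 E) (c : ℝ) : Prop where
  apply_mem : ∀ ⦃x⦄, x ∈ W → T x ∈ W
  norm_apply_le : ∀ ⦃x⦄, x ∈ W → ‖T x‖ ≤ c * ‖x‖

namespace ContractsOn

variable {P Q : Module.End 𝕜 E} {W : Submodule 𝕜 E} {a b : ℝ}

theorem one : ContractsOn (1 : Module.End 𝕜 E) W 1 :=
  ⟨fun _ hx => hx, fun _ _ => by simp⟩

theorem mul (ha : 0 ≤ a) (hP : ContractsOn P W a) (hQ : ContractsOn Q W b) :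
    ContractsOn (P * Q) W (a * b) where
  apply_mem _ hx := hP.apply_mem (hQ.apply_mem hx)
  norm_apply_le x hx := calc
    ‖P (Q x)‖ ≤ a * ‖Q x‖ := hP.norm_apply_le (hQ.apply_mem hx)
    _ ≤ a * (b * ‖x‖) := by gcongr; exact hQ.norm_apply_le hx
    _ = a * b * ‖x‖ := by ring

theorem pow (ha : 0 ≤ a) (hP : ContractsOn P W a) (n : ℕ) : ContractsOn (P ^ n) W (a ^ n) := by
  induction n with
  | zero => simpa only [pow_zero] using one
  | succ n ih => simpa only [pow_succ'] using hP.mul ha ih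

theorem norm_inner_apply_le (hP : ContractsOn P W a) {x : E} (hx : x ∈ W) :
    ‖⟪x, P x⟫_𝕜‖ ≤ a * ‖x‖ ^ 2 := calc
  ‖⟪x, P x⟫_𝕜‖ ≤ ‖x‖ * ‖P x‖ := norm_inner_le_norm _ _
  _ ≤ ‖x‖ * (a * ‖x‖) := by gcongr; exact hP.norm_apply_le hx
  _ = a * ‖x‖ ^ 2 := by ring

theorem orthogonal_of_isSymmetric [FiniteDimensional 𝕜 E] (hP : P.IsSymmetric)
    (hW : W ∈ P.invtSubmodule) (ha : 0 ≤ a)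
    (h : ∀ (μ : ℝ) (x : E), x ≠ 0 → P x = (μ : 𝕜) • x → |μ| ≤ a ∨ x ∈ W) :
    ContractsOn P Wᗮ a where
  apply_mem := hP.orthogonalComplement_mem_invtSubmodule hW
  norm_apply_le x hx := by
    let v := hP.eigenvectorBasis rfl
    let μ := hP.eigenvalues rfl
    have hv (i) : P (v i) = (μ i : 𝕜) • v i := hP.apply_eigenvectorBasis rfl i
    have hcoord (i) : ‖⟪v i, P x⟫_𝕜‖ ≤ a * ‖⟪v i, x⟫_𝕜‖ := by
      rw [← hP, hv, inner_smul_left, norm_mul, RCLike.norm_conj, RCLike.norm_ofReal]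
      rcases h _ _ (v.orthonormal.ne_zero i) (hv i) with hμ | hmem
      · gcongr
      · simp [hx _ hmem]
    refine le_of_sq_le_sq ?_ (by positivity)
    rw [mul_pow, ← v.sum_sq_norm_inner_right, ← v.sum_sq_norm_inner_right x, Finset.mul_sum]
    refine Finset.sum_le_sum fun i _ => ?_
    rw [← mul_pow]
    gcongr
    exact hcoord i

end ContractsOn

theorem exists_norm_apply_le {F : Type*} [NormedAddCommGroup F] [NormedSpace 𝕜 F]
    [FiniteDimensional 𝕜 E] (L : E →ₗ[𝕜] F) : ∃ C, 0 ≤ C ∧ ∀ x, ‖L x‖ ≤ C * ‖x‖ :=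
  ⟨_, norm_nonneg _, L.toContinuousLinearMap.le_opNorm⟩

theorem norm_le_one_of_forall_norm_pow_apply_le {T : Module.End 𝕜 E} {x : E} (hx : x ≠ 0) {μ : 𝕜}
    (hμ : T x = μ • x) {C : ℝ} (hC : ∀ n : ℕ, ‖(T ^ n) x‖ ≤ C) : ‖μ‖ ≤ 1 := by
  by_contra! hlt
  have hpow (n : ℕ) : (T ^ n) x = μ ^ n • x := by
    induction n with
    | zero => simp
    | succ n ih => rw [pow_succ, Module.End.mul_apply, hμ, map_smul, ih, smul_smul, pow_succ']
  obtain ⟨n, hn⟩ := pow_unbounded_of_one_lt (C / ‖x‖) hlt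
  have := hC n
  rw [hpow, norm_smul, norm_pow, ← le_div_iff₀ (norm_pos_iff.2 hx)] at this
  exact this.not_gt hn

end Operators

/-! ### Hermitian matrices -/

theorem exists_pos_nonneg_add_smul {A : Type*} [CStarAlgebra A] [PartialOrder A]
    [StarOrderedRing A] {a b : A} (ha : IsStrictlyPositive a) (hb : IsSelfAdjoint b) :
    ∃ t : ℝ, 0 < t ∧ 0 ≤ a + t • b := by
  cases subsingleton_or_nontrivial A
  · exact ⟨1, one_pos, (Subsingleton.elim _ _).le⟩
  obtain ⟨r, hr, hra⟩ : ∃ r > 0, algebraMap ℝ A r ≤ a :=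
    (CFC.exists_pos_algebraMap_le_iff ha.isSelfAdjoint).2 fun x hx => ha.spectrum_pos hx
  have ht : 0 < r / (‖b‖ + 1) := by positivity
  have htb : -algebraMap ℝ A r ≤ (r / (‖b‖ + 1)) • b := calc
    -algebraMap ℝ A r ≤ -algebraMap ℝ A (r / (‖b‖ + 1) * ‖b‖) := by
      refine neg_le_neg (algebraMap_mono A ?_)
      rw [div_mul_eq_mul_div, div_le_iff₀ (by positivity)]
      nlinarith
    _ = (r / (‖b‖ + 1)) • -algebraMap ℝ A ‖b‖ := by
      rw [map_mul, ← Algebra.smul_def, smul_neg]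
    _ ≤ _ := smul_le_smul_of_nonneg_left hb.neg_algebraMap_norm_le_self ht.le
  exact ⟨_, ht, by simpa using add_le_add hra htb⟩

theorem trace_re_nonneg {d : Type*} [Fintype d] {A : Matrix d d ℂ} (hA : A.PosSemidef) :
    0 ≤ A.trace.re :=
  (Complex.nonneg_iff.1 hA.trace_nonneg).1

open scoped Matrix.Norms.L2Operator MatrixOrder in
theorem exists_pos_posSemidef_add_smul {d : Type*} [Finite d] {A B : Matrix d d ℂ}
    (hA : A.PosDef) (hB : B.IsHermitian) : ∃ t : ℝ, 0 < t ∧ (A + t • B).PosSemidef := by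
  classical
  cases nonempty_fintype d
  simpa only [nonneg_iff_posSemidef] using
    exists_pos_nonneg_add_smul hA.isStrictlyPositive hB.isSelfAdjoint

open scoped MatrixOrder in
theorem span_posSemidef {d : Type*} [Finite d] :
    Submodule.span ℂ {A : Matrix d d ℂ | A.PosSemidef} = ⊤ := by
  classical
  cases nonempty_fintype d
  simpa only [nonneg_iff_posSemidef] using CStarAlgebra.span_nonneg (A := Matrix d d ℂ)

variable {d : Type*} [Fintype d] [DecidableEq d]

theorem continuousOn_spectrum (A : Matrix d d ℂ) (f : ℝ → ℝ) : ContinuousOn f (spectrum ℝ A) :=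
  A.finite_real_spectrum.continuousOn f

theorem trace_cfc {A : Matrix d d ℂ} (hA : A.IsHermitian) (f : ℝ → ℝ) :
    (cfc f A).trace = ((∑ i, f (hA.eigenvalues i) : ℝ) : ℂ) := by
  rw [hA.cfc_eq, Matrix.IsHermitian.cfc, Unitary.conjStarAlgAut_apply, trace_mul_comm,
    ← mul_assoc]
  simp [Matrix.trace]

theorem posSemidef_cfc {A : Matrix d d ℂ} (hA : A.IsHermitian) {f : ℝ → ℝ}
    (hf : ∀ i, 0 ≤ f (hA.eigenvalues i)) : (cfc f A).PosSemidef := by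
  rw [hA.cfc_eq, Matrix.IsHermitian.cfc, Unitary.conjStarAlgAut_apply]
  refine PosSemidef.mul_mul_conjTranspose_same (PosSemidef.diagonal fun i => ?_) _
  simpa using hf i

theorem trace_mul_self_eq_sum_eigenvalues_sq {A : Matrix d d ℂ} (hA : A.IsHermitian) :
    (A * A).trace = ((∑ i, hA.eigenvalues i ^ 2 : ℝ) : ℂ) := by
  rw [← trace_cfc hA (· ^ 2), cfc_pow_id (R := ℝ) A 2 hA.isSelfAdjoint, sq]

theorem trace_re_eq_sum_eigenvalues {A : Matrix d d ℂ} (hA : A.IsHermitian) :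
    A.trace.re = ∑ i, hA.eigenvalues i := by
  simp [hA.trace_eq_sum_eigenvalues]

theorem traceNorm_eq_sum_abs_eigenvalues {A : Matrix d d ℂ} (hA : A.IsHermitian) :
    traceNorm A = ∑ i, |hA.eigenvalues i| := by
  have hAA : Aᴴ * A = cfc (fun x : ℝ => x ^ 2) A := by
    rw [cfc_pow_id (R := ℝ) A 2 hA.isSelfAdjoint, hA.eq, sq]
  have hroots : (Aᴴ * A).charpoly.roots =
      Finset.univ.val.map fun i => (((hA.eigenvalues i) ^ 2 : ℝ) : ℂ) := by
    rw [hAA, hA.charpoly_cfc_eq, Polynomial.roots_prod]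
    · simp only [Polynomial.roots_X_sub_C, Multiset.bind_singleton]
      rfl
    · exact Finset.prod_ne_zero_iff.2 fun i _ => Polynomial.X_sub_C_ne_zero _
  rw [(isHermitian_conjTranspose_mul_self A).roots_charpoly_eq_eigenvalues] at hroots
  have hsum := congrArg (fun m : Multiset ℂ => (m.map fun z => Real.sqrt z.re).sum) hroots
  simp only [Multiset.map_map, Function.comp_def, Complex.ofReal_re, Real.sqrt_sq_eq_abs] at hsum
  exact hsum

theorem exists_posSemidef_sub {A : Matrix d d ℂ} (hA : A.IsHermitian) :
    ∃ B C : Matrix d d ℂ, B.PosSemidef ∧ C.PosSemidef ∧ A = B - C ∧ B.trace.re ≤ traceNorm A := by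
  refine ⟨cfc (fun x : ℝ => max x 0) A, cfc (fun x : ℝ => max x 0 - x) A, ?_, ?_, ?_, ?_⟩
  · exact posSemidef_cfc hA fun i => le_max_right _ _
  · exact posSemidef_cfc hA fun i => sub_nonneg.2 (le_max_left _ _)
  · rw [← cfc_sub _ _ _ (continuousOn_spectrum _ _) (continuousOn_spectrum _ _)]
    simp only [sub_sub_cancel]
    exact (cfc_id' ℝ A hA.isSelfAdjoint).symm
  · rw [trace_cfc hA, traceNorm_eq_sum_abs_eigenvalues hA, Complex.ofReal_re]
    exact Finset.sum_le_sum fun i _ => max_le (le_abs_self _) (abs_nonneg _)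

/-! ### Real powers -/

theorem isHermitian_matPow (ρ : Matrix d d ℂ) (r : ℝ) : (matPow ρ r).IsHermitian :=
  cfc_predicate _ ρ

theorem matPow_zero {ρ : Matrix d d ℂ} (hρ : ρ.IsHermitian) : matPow ρ 0 = 1 := by
  simp only [matPow, Real.rpow_zero]
  exact cfc_const_one ℝ ρ hρ.isSelfAdjoint

theorem matPow_one {ρ : Matrix d d ℂ} (hρ : ρ.IsHermitian) : matPow ρ 1 = ρ := by
  simp only [matPow, Real.rpow_one]
  exact cfc_id' ℝ ρ hρ.isSelfAdjoint

theorem matPow_mul_matPow {ρ : Matrix d d ℂ} (hρ : ρ.PosDef) (r t : ℝ) :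
    matPow ρ r * matPow ρ t = matPow ρ (r + t) := by
  rw [matPow, matPow, matPow, ← cfc_mul _ _ _ (continuousOn_spectrum _ _)
    (continuousOn_spectrum _ _)]
  refine cfc_congr fun x hx => ?_
  rw [hρ.1.spectrum_real_eq_range_eigenvalues] at hx
  obtain ⟨i, rfl⟩ := hx
  exact (Real.rpow_add (hρ.eigenvalues_pos i) _ _).symm

theorem matPow_half_mul_self {ρ : Matrix d d ℂ} (hρ : ρ.PosDef) (r : ℝ) :
    matPow ρ (r / 2) * matPow ρ (r / 2) = matPow ρ r := by
  rw [matPow_mul_matPow hρ, add_halves]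

theorem matPow_mul_matPow_neg {ρ : Matrix d d ℂ} (hρ : ρ.PosDef) (r : ℝ) :
    matPow ρ r * matPow ρ (-r) = 1 := by
  rw [matPow_mul_matPow hρ, add_neg_cancel, matPow_zero hρ.1]

theorem matPow_neg_mul_matPow {ρ : Matrix d d ℂ} (hρ : ρ.PosDef) (r : ℝ) :
    matPow ρ (-r) * matPow ρ r = 1 := by
  rw [matPow_mul_matPow hρ, neg_add_cancel, matPow_zero hρ.1]

/-! ### The Hilbert–Schmidt space -/

/-- The norm `‖A‖ = √tr (A† A)` on matrices. -/
abbrev hilbertSchmidtNormedAddCommGroup : NormedAddCommGroup (Matrix d d ℂ) :=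
  toMatrixNormedAddCommGroup 1 PosDef.one

attribute [local instance] hilbertSchmidtNormedAddCommGroup

/-- The Hilbert–Schmidt inner product `hsInner` as an inner product space structure. -/
abbrev hilbertSchmidtInnerProductSpace : InnerProductSpace ℂ (Matrix d d ℂ) :=
  toMatrixInnerProductSpace 1 PosSemidef.one

attribute [local instance] hilbertSchmidtInnerProductSpace

theorem inner_eq_hsInner (A B : Matrix d d ℂ) : ⟪A, B⟫_ℂ = hsInner A B := by
  have : ⟪A, B⟫_ℂ = (B * 1 * Aᴴ).trace := rfl
  rw [this, mul_one, trace_mul_comm, hsInner]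

theorem inner_one_left (A : Matrix d d ℂ) : ⟪1, A⟫_ℂ = A.trace := by
  simp [inner_eq_hsInner, hsInner]

theorem norm_sq_eq_sum_eigenvalues_sq {A : Matrix d d ℂ} (hA : A.IsHermitian) :
    ‖A‖ ^ 2 = ∑ i, hA.eigenvalues i ^ 2 := by
  rw [← inner_self_eq_norm_sq (𝕜 := ℂ), inner_eq_hsInner, hsInner, hA.eq,
    trace_mul_self_eq_sum_eigenvalues_sq hA]
  exact Complex.ofReal_re _

theorem norm_le_trace {A : Matrix d d ℂ} (hA : A.PosSemidef) : ‖A‖ ≤ A.trace.re := by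
  refine le_of_sq_le_sq ?_ (trace_re_nonneg hA)
  rw [norm_sq_eq_sum_eigenvalues_sq hA.1, trace_re_eq_sum_eigenvalues hA.1]
  exact Finset.sum_sq_le_sq_sum_of_nonneg fun i _ => hA.eigenvalues_nonneg i

theorem IsState.norm_le_one {σ : Matrix d d ℂ} (hσ : IsState σ) : ‖σ‖ ≤ 1 := by
  simpa [hσ.2] using norm_le_trace hσ.1

theorem traceNorm_le_sqrt_card_mul_norm {A : Matrix d d ℂ} (hA : A.IsHermitian) :
    traceNorm A ≤ √(Fintype.card d) * ‖A‖ := by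
  refine le_of_sq_le_sq ?_ (by positivity)
  rw [traceNorm_eq_sum_abs_eigenvalues hA, mul_pow, Real.sq_sqrt (by positivity),
    norm_sq_eq_sum_eigenvalues_sq hA]
  simpa using sq_sum_le_card_mul_sum_sq (s := Finset.univ) (f := fun i => |hA.eigenvalues i|)

/-! ### Positive trace-preserving maps -/

/-- Positive trace-preserving maps: the part of the structure of a quantum channel that remains
when complete positivity is weakened to positivity. -/
structure IsPositiveTracePreserving (T : SuperOp d) : Prop where
  posSemidef_apply : ∀ ⦃A⦄, A.PosSemidef → (T A).PosSemidef
  trace_apply : ∀ A, (T A).trace = A.trace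

theorem posSemidef_conjBy (O : Matrix d d ℂ) {A : Matrix d d ℂ} (hA : A.PosSemidef) :
    (conjBy O A).PosSemidef :=
  hA.mul_mul_conjTranspose_same O

theorem isPositiveTracePreserving_sum_conjBy {κ : Type*} [Fintype κ] {Q : κ → Matrix d d ℂ}
    (hQ : ∑ u, (Q u)ᴴ * Q u = 1) : IsPositiveTracePreserving (∑ u, conjBy (Q u)) where
  posSemidef_apply A hA := by
    rw [LinearMap.sum_apply]
    exact posSemidef_sum _ fun u _ => posSemidef_conjBy _ hA
  trace_apply A := calc
    ((∑ u, conjBy (Q u)) A).trace = ∑ u, ((Q u)ᴴ * Q u * A).trace := by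
      rw [LinearMap.sum_apply, trace_sum]
      exact Finset.sum_congr rfl fun u _ => trace_mul_cycle _ _ _
    _ = A.trace := by rw [← trace_sum, ← Finset.sum_mul, hQ, one_mul]

theorem IsChannel.isPositiveTracePreserving {T : SuperOp d} (hT : IsChannel T) :
    IsPositiveTracePreserving T := by
  obtain ⟨_, _, hQ, rfl⟩ := hT
  exact isPositiveTracePreserving_sum_conjBy hQ

namespace IsPositiveTracePreserving

variable {S T : SuperOp d}

theorem mul (hS : IsPositiveTracePreserving S) (hT : IsPositiveTracePreserving T) :
    IsPositiveTracePreserving (S * T) where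
  posSemidef_apply _ hA := hS.posSemidef_apply (hT.posSemidef_apply hA)
  trace_apply A := (hS.trace_apply (T A)).trans (hT.trace_apply A)

theorem pow (hT : IsPositiveTracePreserving T) (n : ℕ) : IsPositiveTracePreserving (T ^ n) := by
  induction n with
  | zero => exact ⟨fun _ hA => hA, fun _ => rfl⟩
  | succ n ih => exact ih.mul hT

theorem isState_apply (hT : IsPositiveTracePreserving T) {σ : Matrix d d ℂ} (hσ : IsState σ) :
    IsState (T σ) :=
  ⟨hT.posSemidef_apply hσ.1, (hT.trace_apply σ).trans hσ.2⟩

theorem map_conjTranspose (hT : IsPositiveTracePreserving T) (X : Matrix d d ℂ) :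
    T Xᴴ = (T X)ᴴ := by
  have hX : X ∈ Submodule.span ℂ {A : Matrix d d ℂ | A.PosSemidef} := by
    rw [span_posSemidef]
    exact Submodule.mem_top
  induction hX using Submodule.span_induction with
  | mem A hA => rw [hA.1.eq, (hT.posSemidef_apply hA).1.eq]
  | zero => simp
  | add A B _ _ hA hB => rw [conjTranspose_add, map_add, hA, hB, map_add, conjTranspose_add]
  | smul c A _ hA => rw [conjTranspose_smul, map_smul, hA, map_smul, conjTranspose_smul]

theorem exists_norm_pow_apply_le (hT : IsPositiveTracePreserving T) (X : Matrix d d ℂ) :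
    ∃ C, ∀ n : ℕ, ‖(T ^ n) X‖ ≤ C := by
  have hX : X ∈ Submodule.span ℂ {A : Matrix d d ℂ | A.PosSemidef} := by
    rw [span_posSemidef]
    exact Submodule.mem_top
  induction hX using Submodule.span_induction with
  | mem A hA =>
    refine ⟨A.trace.re, fun n => ?_⟩
    simpa only [(hT.pow n).trace_apply] using norm_le_trace ((hT.pow n).posSemidef_apply hA)
  | zero => exact ⟨0, by simp⟩
  | add A B _ _ hA hB =>
    obtain ⟨a, ha⟩ := hA
    obtain ⟨b, hb⟩ := hB
    exact ⟨a + b, fun n => map_add (T ^ n) A B ▸ norm_add_le_of_le (ha n) (hb n)⟩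
  | smul c A _ hA =>
    obtain ⟨a, ha⟩ := hA
    refine ⟨‖c‖ * a, fun n => ?_⟩
    rw [map_smul, norm_smul]
    exact mul_le_mul_of_nonneg_left (ha n) (norm_nonneg c)

theorem norm_eigenvalue_le_one (hT : IsPositiveTracePreserving T) {X : Matrix d d ℂ} (hX : X ≠ 0)
    {μ : ℂ} (hμ : T X = μ • X) : ‖μ‖ ≤ 1 :=
  let ⟨_, hC⟩ := hT.exists_norm_pow_apply_le X
  norm_le_one_of_forall_norm_pow_apply_le hX hμ hC

end IsPositiveTracePreserving

namespace UniqueFixedState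

variable {T : SuperOp d} {ρ X : Matrix d d ℂ}

theorem eq_trace_smul_of_posSemidef (h : UniqueFixedState T ρ) (hX : X.PosSemidef)
    (hTX : T X = X) : X = X.trace • ρ := by
  by_cases h0 : X.trace = 0
  · rw [h0, zero_smul, hX.trace_eq_zero_iff.1 h0]
  · have hstate : IsState (X.trace⁻¹ • X) :=
      ⟨hX.smul (inv_nonneg.2 hX.trace_nonneg), by simp [h0]⟩
    rw [← h.2.2 _ hstate (by rw [map_smul, hTX]), smul_inv_smul₀ h0]

theorem eq_trace_smul_of_isHermitian (hρ : ρ.PosDef) (h : UniqueFixedState T ρ)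
    (hX : X.IsHermitian) (hTX : T X = X) : X = X.trace • ρ := by
  obtain ⟨t, ht, hpos⟩ := exists_pos_posSemidef_add_smul hρ hX
  have hsum := h.eq_trace_smul_of_posSemidef hpos
    (by rw [map_add, LinearMap.map_smul_of_tower, hTX, h.2.1])
  rw [trace_add, trace_smul, h.1.2, add_smul, one_smul, add_right_inj, smul_assoc] at hsum
  exact smul_right_injective _ ht.ne' hsum

theorem eq_trace_smul (hρ : ρ.PosDef) (h : UniqueFixedState T ρ)
    (hT : IsPositiveTracePreserving T) (hTX : T X = X) : X = X.trace • ρ := by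
  have hTX' : T Xᴴ = Xᴴ := by rw [hT.map_conjTranspose, hTX]
  have hre := h.eq_trace_smul_of_isHermitian hρ (X := X + Xᴴ)
    (isHermitian_add_transpose_self X) (by rw [map_add, hTX, hTX'])
  have him := h.eq_trace_smul_of_isHermitian hρ (X := Complex.I • (X - Xᴴ))
    (by simp [IsHermitian, smul_sub, neg_add_eq_sub]) (by rw [map_smul, map_sub, hTX, hTX'])
  rw [trace_smul, smul_assoc] at him
  have hdiff := smul_right_injective _ Complex.I_ne_zero him
  rw [trace_add] at hre
  rw [trace_sub] at hdiff
  calc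
    X = (1 / 2 : ℂ) • ((X + Xᴴ) + (X - Xᴴ)) := by module
    _ = X.trace • ρ := by rw [hre, hdiff]; module

end UniqueFixedState

/-! ### Detailed balance -/

section DetailedBalance

/-- The map `A ↦ ρ^((1-s)/2) A ρ^(s/2)`, an isometry from `⟨·,·⟩_s` to the Hilbert–Schmidt inner
product. Its value at `1` is `√ρ`, and its square sends `1` to `ρ`. -/
def symmetrizer {ρ : Matrix d d ℂ} (hρ : ρ.PosDef) (s : ℝ) :
    Matrix d d ℂ ≃ₗ[ℂ] Matrix d d ℂ where
  toFun A := matPow ρ ((1 - s) / 2) * A * matPow ρ (s / 2)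
  invFun A := matPow ρ (-((1 - s) / 2)) * A * matPow ρ (-(s / 2))
  map_add' A B := by rw [mul_add, add_mul]
  map_smul' c A := by simp
  left_inv A := by
    dsimp only
    rw [mul_assoc, mul_assoc, matPow_mul_matPow_neg hρ,
      mul_one, ← mul_assoc, matPow_neg_mul_matPow hρ, one_mul]
  right_inv A := by
    dsimp only
    rw [mul_assoc, mul_assoc, matPow_neg_mul_matPow hρ,
      mul_one, ← mul_assoc, matPow_mul_matPow_neg hρ, one_mul]

variable {ρ : Matrix d d ℂ} (hρ : ρ.PosDef) (s : ℝ)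

theorem symmetrizer_apply (A : Matrix d d ℂ) :
    symmetrizer hρ s A = matPow ρ ((1 - s) / 2) * A * matPow ρ (s / 2) := rfl

theorem symmetrizer_symmetrizer (A : Matrix d d ℂ) :
    symmetrizer hρ s (symmetrizer hρ s A) = matPow ρ (1 - s) * A * matPow ρ s := by
  rw [symmetrizer_apply, symmetrizer_apply, ← matPow_half_mul_self hρ (1 - s),
    ← matPow_half_mul_self hρ s]
  simp only [mul_assoc]

theorem symmetrizer_symmetrizer_one : symmetrizer hρ s (symmetrizer hρ s 1) = ρ := by
  rw [symmetrizer_symmetrizer, mul_one, matPow_mul_matPow hρ, sub_add_cancel, matPow_one hρ.1]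

theorem inner_symmetrizer_left (A B : Matrix d d ℂ) :
    ⟪symmetrizer hρ s A, B⟫_ℂ = ⟪A, symmetrizer hρ s B⟫_ℂ := by
  simp only [inner_eq_hsInner, hsInner, symmetrizer_apply, conjTranspose_mul,
    (isHermitian_matPow ρ _).eq]
  rw [mul_assoc, trace_mul_comm]
  simp only [mul_assoc]

theorem inner_symmetrizer_one (A : Matrix d d ℂ) :
    ⟪symmetrizer hρ s 1, A⟫_ℂ = (symmetrizer hρ s A).trace := by
  rw [inner_symmetrizer_left, inner_one_left]

theorem weightedInner_eq_inner (A B : Matrix d d ℂ) :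
    weightedInner s ρ A B = ⟪A, symmetrizer hρ s (symmetrizer hρ s B)⟫_ℂ := by
  rw [symmetrizer_symmetrizer, inner_eq_hsInner, weightedInner, hsInner]
  simp only [mul_assoc]

/-- The conjugate `S⁻¹ T S` of `T` by the symmetrizer `S`, known as the quantum discriminant. -/
def discriminant : SuperOp d ≃ₐ[ℂ] SuperOp d :=
  (symmetrizer hρ s).symm.conjAlgEquiv ℂ

theorem symmetrizer_discriminant (T : SuperOp d) (A : Matrix d d ℂ) :
    symmetrizer hρ s (discriminant hρ s T A) = T (symmetrizer hρ s A) :=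
  (symmetrizer hρ s).apply_symm_apply _

variable {s} {T : SuperOp d}

theorem DetailedBalance.isSymmetric_discriminant (hT : DetailedBalance s ρ T) :
    (discriminant hρ s T).IsSymmetric := by
  have hdual (X Y : Matrix d d ℂ) : ⟪X, dual T Y⟫_ℂ = ⟪T X, Y⟫_ℂ := by
    simp only [inner_eq_hsInner, hsInner_dual]
  have hdiscriminant (B : Matrix d d ℂ) :
      discriminant hρ s T (symmetrizer hρ s B) = symmetrizer hρ s (dual T B) := by
    refine (symmetrizer hρ s).injective (ext_inner_left ℂ fun A => ?_)
    rw [symmetrizer_discriminant, ← weightedInner_eq_inner, hT, weightedInner_eq_inner hρ,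
      ← inner_conj_symm (dual T A), hdual, inner_conj_symm]
  intro A B
  obtain ⟨A, rfl⟩ := (symmetrizer hρ s).surjective A
  obtain ⟨B, rfl⟩ := (symmetrizer hρ s).surjective B
  rw [hdiscriminant, hdiscriminant, inner_symmetrizer_left, inner_symmetrizer_left,
    ← weightedInner_eq_inner, ← weightedInner_eq_inner, hT]

theorem DetailedBalance.inner_discriminant_symmetrizer_one (hT : DetailedBalance s ρ T)
    (A : Matrix d d ℂ) :
    ⟪discriminant hρ s T (symmetrizer hρ s 1), A⟫_ℂ = (T (symmetrizer hρ s A)).trace := by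
  rw [hT.isSymmetric_discriminant hρ, inner_symmetrizer_one, symmetrizer_discriminant]

theorem DetailedBalance.discriminant_symmetrizer_one (hT : DetailedBalance s ρ T)
    (hT' : IsPositiveTracePreserving T) :
    discriminant hρ s T (symmetrizer hρ s 1) = symmetrizer hρ s 1 :=
  ext_inner_right ℂ fun A => by
    rw [hT.inner_discriminant_symmetrizer_one, hT'.trace_apply, inner_symmetrizer_one]

include hρ in
theorem DetailedBalance.apply_self (hT : DetailedBalance s ρ T)
    (hT' : IsPositiveTracePreserving T) : T ρ = ρ := by
  rw [← symmetrizer_symmetrizer_one hρ s, ← symmetrizer_discriminant,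
    hT.discriminant_symmetrizer_one hρ hT']

variable (s) in
/-- The orthogonal complement of `√ρ`, which the symmetrizer maps onto the traceless matrices. -/
def symmetrizedTraceless : Submodule ℂ (Matrix d d ℂ) :=
  (ℂ ∙ symmetrizer hρ s 1)ᗮ

theorem mem_symmetrizedTraceless {A : Matrix d d ℂ} :
    A ∈ symmetrizedTraceless hρ s ↔ (symmetrizer hρ s A).trace = 0 := by
  rw [symmetrizedTraceless, Submodule.mem_orthogonal_singleton_iff_inner_right,
    inner_symmetrizer_one]

theorem DetailedBalance.contractsOn_discriminant (hT : DetailedBalance s ρ T)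
    (hT' : IsPositiveTracePreserving T) {a : ℝ} (ha : 0 ≤ a)
    (h : ∀ (μ : ℝ) (X : Matrix d d ℂ), X ≠ 0 → T X = (μ : ℂ) • X → |μ| ≤ a ∨ X = X.trace • ρ) :
    ContractsOn (discriminant hρ s T) (symmetrizedTraceless hρ s) a := by
  refine .orthogonal_of_isSymmetric (hT.isSymmetric_discriminant hρ) ?_ ha fun μ A hA hμ => ?_
  · rw [Module.End.mem_invtSubmodule, Submodule.span_singleton_le_iff_mem, Submodule.mem_comap,
      hT.discriminant_symmetrizer_one hρ hT']
    exact Submodule.mem_span_singleton_self _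
  · refine (h μ (symmetrizer hρ s A) ((map_ne_zero_iff _ (symmetrizer hρ s).injective).2 hA)
      ?_).imp_right fun hAρ => ?_
    · rw [← symmetrizer_discriminant, hμ]
      exact map_smul _ _ _
    · refine Submodule.mem_span_singleton.2
        ⟨(symmetrizer hρ s A).trace, (symmetrizer hρ s).injective ?_⟩
      rw [map_smul, symmetrizer_symmetrizer_one, ← hAρ]

theorem DetailedBalance.contractsOn_discriminant_one (hT : DetailedBalance s ρ T)
    (hT' : IsPositiveTracePreserving T) :
    ContractsOn (discriminant hρ s T) (symmetrizedTraceless hρ s) 1 :=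
  hT.contractsOn_discriminant hρ hT' zero_le_one fun μ X hX hμ =>
    .inl (by simpa using hT'.norm_eigenvalue_le_one hX hμ)

theorem exists_norm_pow_apply_le_of_trace_eq_zero {a : ℝ} (ha : 0 ≤ a)
    (hT : ContractsOn (discriminant hρ s T) (symmetrizedTraceless hρ s) a) :
    ∃ C, ∀ X : Matrix d d ℂ, X.trace = 0 → ∀ t : ℕ, ‖(T ^ t) X‖ ≤ C * a ^ t * ‖X‖ := by
  obtain ⟨b, hb, hS⟩ := exists_norm_apply_le (symmetrizer hρ s).toLinearMap
  obtain ⟨c, _, hS'⟩ := exists_norm_apply_le (symmetrizer hρ s).symm.toLinearMap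
  refine ⟨b * c, fun X hX t => ?_⟩
  obtain ⟨A, rfl⟩ := (symmetrizer hρ s).surjective X
  have hA' : ‖A‖ ≤ c * ‖symmetrizer hρ s A‖ := by simpa using hS' (symmetrizer hρ s A)
  have hA : A ∈ symmetrizedTraceless hρ s := (mem_symmetrizedTraceless hρ).2 hX
  calc
    ‖(T ^ t) (symmetrizer hρ s A)‖ = ‖symmetrizer hρ s ((discriminant hρ s T ^ t) A)‖ := by
      rw [← map_pow, symmetrizer_discriminant]
    _ ≤ b * (a ^ t * (c * ‖symmetrizer hρ s A‖)) := by
      refine (hS _).trans ?_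
      grw [(hT.pow ha t).norm_apply_le hA, hA']
    _ = b * c * a ^ t * ‖symmetrizer hρ s A‖ := by ring

theorem traceNorm_mixingTime_le (hρ' : IsState ρ) (hT : IsPositiveTracePreserving T)
    (hTρ : T ρ = ρ) {a : ℝ} (ha : 0 ≤ a) (ha' : a < 1)
    (hTa : ContractsOn (discriminant hρ s T) (symmetrizedTraceless hρ s) a)
    {η : ℝ} (hη : 0 < η) {σ : Matrix d d ℂ} (hσ : IsState σ) :
    traceNorm ((T ^ mixingTime T ρ η) σ - ρ) ≤ η := by
  obtain ⟨C, hC⟩ := exists_norm_pow_apply_le_of_trace_eq_zero hρ ha hTa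
  have hbound (t : ℕ) {σ : Matrix d d ℂ} (hσ : IsState σ) :
      traceNorm ((T ^ t) σ - ρ) ≤ √(Fintype.card d) * (|C| * 2) * a ^ t := by
    have hdiff : (T ^ t) σ - ρ = (T ^ t) (σ - ρ) := by
      rw [map_sub, Module.End.pow_apply T t ρ, Function.iterate_fixed hTρ]
    have hnorm : ‖σ - ρ‖ ≤ 2 :=
      (norm_sub_le _ _).trans (by linarith [hσ.norm_le_one, hρ'.norm_le_one])
    calc
      traceNorm ((T ^ t) σ - ρ) ≤ √(Fintype.card d) * ‖(T ^ t) (σ - ρ)‖ :=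
        hdiff ▸ traceNorm_le_sqrt_card_mul_norm
          (((hT.pow t).isState_apply hσ).1.1.sub hρ.1)
      _ ≤ √(Fintype.card d) * (|C| * a ^ t * 2) := by
        grw [hC _ (by rw [trace_sub, hσ.2, hρ'.2, sub_self]) t, le_abs_self C, hnorm]
      _ = √(Fintype.card d) * (|C| * 2) * a ^ t := by ring
  have hlim := (tendsto_pow_atTop_nhds_zero_of_lt_one ha ha').const_mul
    (√(Fintype.card d) * (|C| * 2))
  rw [mul_zero] at hlim
  obtain ⟨t, ht⟩ := (hlim.eventually_le_const hη).exists
  exact Nat.sInf_mem (s := {t | ∀ σ, IsState σ → traceNorm ((T ^ t) σ - ρ) ≤ η})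
    ⟨t, fun σ hσ => (hbound t hσ).trans ht⟩ σ hσ

end DetailedBalance

/-! ### The spectral gap -/

section Gap

variable {N : SuperOp d} (hN : spectrum ℂ N ⊆ (fun x : ℝ => (x : ℂ)) '' Set.Icc (0 : ℝ) 1)

theorem finite_setOf_ne_one_mem_spectrum (N : SuperOp d) :
    {x : ℝ | x ≠ 1 ∧ (x : ℂ) ∈ spectrum ℂ N}.Finite :=
  ((Module.End.finite_spectrum N).preimage Complex.ofReal_injective.injOn).subset fun _ hx => hx.2

include hN

theorem mem_Icc_of_mem_spectrum {x : ℝ} (hx : (x : ℂ) ∈ spectrum ℂ N) : x ∈ Set.Icc (0 : ℝ) 1 := by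
  obtain ⟨y, hy, hyx⟩ := hN hx
  exact Complex.ofReal_injective hyx ▸ hy

theorem gap_le_one : gap N ≤ 1 :=
  sub_le_self _ (Real.sSup_nonneg fun _ hx => (mem_Icc_of_mem_spectrum hN hx.2).1)

theorem gap_pos : 0 < gap N := by
  rw [gap, sub_pos]
  rcases Set.eq_empty_or_nonempty {x : ℝ | x ≠ 1 ∧ (x : ℂ) ∈ spectrum ℂ N} with hS | hS
  · rw [hS, Real.sSup_empty]
    exact one_pos
  · obtain ⟨hne, hmem⟩ := hS.csSup_mem (finite_setOf_ne_one_mem_spectrum N)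
    exact (mem_Icc_of_mem_spectrum hN hmem).2.lt_of_ne hne

theorem abs_le_one_sub_gap {μ : ℝ} (hμ : (μ : ℂ) ∈ spectrum ℂ N) (hμ1 : μ ≠ 1) :
    |μ| ≤ 1 - gap N := by
  rw [abs_of_nonneg (mem_Icc_of_mem_spectrum hN hμ).1, gap, sub_sub_cancel]
  exact le_csSup (finite_setOf_ne_one_mem_spectrum N).bddAbove ⟨hμ1, hμ⟩

theorem contractsOn_discriminant_one_sub_gap {ρ : Matrix d d ℂ} (hρ : ρ.PosDef) {s : ℝ}
    (hNpos : IsPositiveTracePreserving N) (hNdb : DetailedBalance s ρ N)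
    (hNfix : UniqueFixedState N ρ) :
    ContractsOn (discriminant hρ s N) (symmetrizedTraceless hρ s) (1 - gap N) := by
  refine hNdb.contractsOn_discriminant hρ hNpos (sub_nonneg.2 (gap_le_one hN)) fun μ X hX hμ => ?_
  rcases eq_or_ne μ 1 with rfl | hμ1
  · exact .inr (hNfix.eq_trace_smul hρ hNpos (by simpa using hμ))
  · exact .inl (abs_le_one_sub_gap hN (Module.End.hasEigenvalue_of_hasEigenvector
      (Module.End.hasEigenvector_iff.2 ⟨Module.End.mem_eigenspace_iff.2 hμ, hX⟩)).mem_spectrum hμ1)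

end Gap

namespace Measurement

variable {ι : Type*} [Fintype ι] (M : Measurement d ι) (ρ : Matrix d d ℂ)

/-! ### Measurements -/

theorem isPositiveTracePreserving_channel : IsPositiveTracePreserving M.channel :=
  isPositiveTracePreserving_sum_conjBy M.complete

theorem channel_apply (X : Matrix d d ℂ) : M.channel X = ∑ u, conjBy (M.kraus u) X := by
  rw [channel, LinearMap.sum_apply]

theorem hat_apply (X : Matrix d d ℂ) :
    M.hat ρ X = ∑ u, (M.outcome u - M.expectation ρ) • conjBy (M.kraus u) X := by
  simp only [hat, LinearMap.sum_apply, LinearMap.smul_apply, Complex.coe_smul]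

theorem sum_trace_conjBy_re (X : Matrix d d ℂ) :
    ∑ u, (conjBy (M.kraus u) X).trace.re = X.trace.re := by
  rw [← M.isPositiveTracePreserving_channel.trace_apply X, channel_apply, trace_sum, Complex.re_sum]

theorem trace_hat_re (X : Matrix d d ℂ) :
    (M.hat ρ X).trace.re =
      ∑ u, (M.outcome u - M.expectation ρ) * (conjBy (M.kraus u) X).trace.re := by
  simp only [hat_apply, trace_sum, Complex.re_sum, trace_smul, Complex.smul_re, smul_eq_mul]

variable {ρ}

theorem trace_hat_self (hρ : IsState ρ) : (M.hat ρ ρ).trace = 0 := by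
  apply Complex.ext
  · rw [trace_hat_re]
    simp only [sub_mul, Finset.sum_sub_distrib, ← Finset.mul_sum, sum_trace_conjBy_re, hρ.2]
    simp [expectation]
  · rw [hat_apply, trace_sum, Complex.im_sum]
    refine Finset.sum_eq_zero fun u _ => ?_
    rw [trace_smul, Complex.smul_im,
      ← (Complex.nonneg_iff.1 (posSemidef_conjBy (M.kraus u) hρ.1).trace_nonneg).2]
    exact smul_zero _

variable (ρ) in
theorem covariance_eq_trace_hat_hat : M.covariance ρ = (M.hat ρ (M.hat ρ ρ)).trace.re := by
  rw [trace_hat_re, covariance, Finset.sum_comm]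
  refine Finset.sum_congr rfl fun y _ => ?_
  rw [hat_apply, map_sum, trace_sum, Complex.re_sum, Finset.mul_sum]
  refine Finset.sum_congr rfl fun x _ => ?_
  rw [LinearMap.map_smul_of_tower, trace_smul, Complex.smul_re, smul_eq_mul, mul_left_comm,
    mul_assoc]

variable (ρ) in
theorem variance_eq : M.variance ρ =
    ∑ u, (M.outcome u - M.expectation ρ) ^ 2 * (conjBy (M.kraus u) ρ).trace.re := by
  simp only [variance, sq_abs]

theorem variance_nonneg (hρ : ρ.PosSemidef) : 0 ≤ M.variance ρ :=
  Finset.sum_nonneg fun _ _ => mul_nonneg (by positivity) (trace_re_nonneg (posSemidef_conjBy _ hρ))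

theorem covariance_le_variance (hρ : ρ.PosSemidef) (hfix : M.channel ρ = ρ) :
    M.covariance ρ ≤ M.variance ρ := by
  let f (u : ι) : ℝ := M.outcome u - M.expectation ρ
  let q (x y : ι) : ℝ := (conjBy (M.kraus y) (conjBy (M.kraus x) ρ)).trace.re
  have hq (x y) : 0 ≤ q x y := trace_re_nonneg (posSemidef_conjBy _ (posSemidef_conjBy _ hρ))
  have hfst (x) : ∑ y, q x y = (conjBy (M.kraus x) ρ).trace.re := M.sum_trace_conjBy_re _
  have hsnd (y) : ∑ x, q x y = (conjBy (M.kraus y) ρ).trace.re := by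
    rw [← Complex.re_sum, ← trace_sum, ← map_sum, ← channel_apply, hfix]
  calc
    M.covariance ρ = ∑ x, ∑ y, f x * f y * q x y := rfl
    _ ≤ ∑ x, ∑ y, (f x ^ 2 / 2 * q x y + f y ^ 2 / 2 * q x y) := by
      gcongr with x _ y _
      rw [← add_mul]
      gcongr
      · exact hq x y
      · linarith [two_mul_le_add_sq (f x) (f y)]
    _ = (∑ x, f x ^ 2 / 2 * ∑ y, q x y) + ∑ y, f y ^ 2 / 2 * ∑ x, q x y := by
      simp only [Finset.sum_add_distrib, Finset.mul_sum]
      rw [Finset.sum_comm (f := fun x y => f y ^ 2 / 2 * q x y)]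
    _ = M.variance ρ := by
      simp only [hfst, hsnd, variance_eq, ← Finset.sum_add_distrib, ← add_mul, add_halves, f]

/-! ### Autocovariances under detailed balance -/

section DetailedBalance

variable {N : SuperOp d} {s : ℝ} (hρ : ρ.PosDef)

/-- The covariance, in the stationary state `ρ`, of two recorded outcomes that are `j + 1` rounds
apart: they are separated by the end `M N` of one round and by `j` complete rounds `M N M`. -/
def lagCovariance (M : Measurement d ι) (N : SuperOp d) (ρ : Matrix d d ℂ) (j : ℕ) : ℝ :=
  (M.hat ρ (((M.channel * N * M.channel) ^ j * (M.channel * N)) (M.hat ρ ρ))).trace.re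

theorem trace_hat_apply_hat_self (hM : DetailedBalance s ρ (M.hat ρ)) (T : SuperOp d) :
    (M.hat ρ (T (M.hat ρ ρ))).trace =
      ⟪discriminant hρ s (M.hat ρ) (symmetrizer hρ s 1),
        discriminant hρ s T (discriminant hρ s (M.hat ρ) (symmetrizer hρ s 1))⟫_ℂ := by
  rw [hM.inner_discriminant_symmetrizer_one, symmetrizer_discriminant, symmetrizer_discriminant,
    symmetrizer_symmetrizer_one]

theorem covariance_eq_norm_sq (hM : DetailedBalance s ρ (M.hat ρ)) :
    M.covariance ρ = ‖discriminant hρ s (M.hat ρ) (symmetrizer hρ s 1)‖ ^ 2 := by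
  have h := M.trace_hat_apply_hat_self hρ hM 1
  rw [map_one (discriminant hρ s), Module.End.one_apply, Module.End.one_apply] at h
  rw [covariance_eq_trace_hat_hat, h, ← inner_self_eq_norm_sq (𝕜 := ℂ)]
  rfl

include hρ in
theorem covariance_nonneg (hM : DetailedBalance s ρ (M.hat ρ)) : 0 ≤ M.covariance ρ :=
  M.covariance_eq_norm_sq hρ hM ▸ sq_nonneg _

theorem lagCovariance_le (hρ' : IsState ρ) {a : ℝ} (ha : 0 ≤ a)
    (hN : ContractsOn (discriminant hρ s N) (symmetrizedTraceless hρ s) a)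
    (hM : DetailedBalance s ρ M.channel) (hMhat : DetailedBalance s ρ (M.hat ρ)) (j : ℕ) :
    M.lagCovariance N ρ j ≤ a ^ (j + 1) * M.covariance ρ := by
  have hM1 := hM.contractsOn_discriminant_one hρ M.isPositiveTracePreserving_channel
  have hcontract : ContractsOn
      (discriminant hρ s ((M.channel * N * M.channel) ^ j * (M.channel * N)))
      (symmetrizedTraceless hρ s) (a ^ (j + 1)) := by
    have hMN := hM1.mul zero_le_one hN
    rw [one_mul] at hMN
    have hMNM := hMN.mul ha hM1
    rw [mul_one] at hMNM
    simpa only [map_mul, map_pow, pow_succ] using (hMNM.pow ha j).mul (pow_nonneg ha j) hMN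
  have htraceless :
      discriminant hρ s (M.hat ρ) (symmetrizer hρ s 1) ∈ symmetrizedTraceless hρ s := by
    rw [mem_symmetrizedTraceless, symmetrizer_discriminant, symmetrizer_symmetrizer_one,
      M.trace_hat_self hρ']
  rw [lagCovariance, M.trace_hat_apply_hat_self hρ hMhat, M.covariance_eq_norm_sq hρ hMhat]
  exact (Complex.re_le_norm _).trans (hcontract.norm_inner_apply_le htraceless)

theorem sum_lagCovariance_le (hρ' : IsState ρ) {a : ℝ} (ha : 0 ≤ a) (ha' : a < 1)
    (hN : ContractsOn (discriminant hρ s N) (symmetrizedTraceless hρ s) a)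
    (hM : DetailedBalance s ρ M.channel) (hMhat : DetailedBalance s ρ (M.hat ρ)) (k : ℕ) :
    ∑ j ∈ Finset.range k, M.lagCovariance N ρ j ≤ M.covariance ρ / (1 - a) := by
  have hcov := M.covariance_nonneg hρ hMhat
  calc
    ∑ j ∈ Finset.range k, M.lagCovariance N ρ j
        ≤ ∑ j ∈ Finset.range k, a ^ j * M.covariance ρ := by
      refine Finset.sum_le_sum fun j _ => (M.lagCovariance_le hρ hρ' ha hN hM hMhat j).trans ?_
      gcongr ?_ * _
      exact pow_le_pow_of_le_one ha ha'.le j.le_succ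
    _ = (∑ j ∈ Finset.range k, a ^ j) * M.covariance ρ := by rw [Finset.sum_mul]
    _ ≤ (1 - a)⁻¹ * M.covariance ρ := by
      gcongr
      rw [← tsum_geometric_of_lt_one ha ha']
      exact (summable_geometric_of_lt_one ha ha').sum_le_tsum _ fun j _ => pow_nonneg ha j
    _ = M.covariance ρ / (1 - a) := by rw [div_eq_inv_mul]

end DetailedBalance

/-! ### Trajectories -/

variable (ρ)

section Trajectories

variable (N : SuperOp d)

theorem trajectoryState_add (l : List ι) (σ τ : Matrix d d ℂ) :
    M.trajectoryState N l (σ + τ) = M.trajectoryState N l σ + M.trajectoryState N l τ := by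
  induction l generalizing σ τ with
  | nil => rfl
  | cons u l ih => simp only [trajectoryState, map_add, ih]

theorem trajectoryState_smul (l : List ι) (c : ℝ) (σ : Matrix d d ℂ) :
    M.trajectoryState N l (c • σ) = c • M.trajectoryState N l σ := by
  induction l generalizing σ with
  | nil => rfl
  | cons u l ih => simp only [trajectoryState, LinearMap.map_smul_of_tower, ih]

variable {N} in
theorem trajectoryProb_nonneg (hN : IsPositiveTracePreserving N) {σ : Matrix d d ℂ}
    (hσ : σ.PosSemidef) {K : ℕ} (x : Fin K → ι) : 0 ≤ M.trajectoryProb N σ x := by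
  suffices ∀ l, (M.trajectoryState N l σ).PosSemidef from trace_re_nonneg (this _)
  intro l
  induction l generalizing σ with
  | nil => exact hσ
  | cons u _ ih =>
    exact ih (M.isPositiveTracePreserving_channel.posSemidef_apply
      (hN.posSemidef_apply (posSemidef_conjBy _ hσ)))

theorem trajectoryProb_cons (σ : Matrix d d ℂ) {K : ℕ} (u : ι) (y : Fin K → ι) :
    M.trajectoryProb N σ (Fin.cons u y : Fin (K + 1) → ι) =
      M.trajectoryProb N (M.channel (N (conjBy (M.kraus u) σ))) y := by
  simp [trajectoryProb, List.ofFn_succ, trajectoryState]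

/-- The expectation of `F` over trajectories of `K` rounds, as a functional of the initial state.
It is extended linearly to all matrices, since the proofs condition on the first outcome, which
produces unnormalized states, and weight such states by the centred outcomes. -/
def trajectoryMean {K : ℕ} (F : (Fin K → ι) → ℝ) : Matrix d d ℂ →ₗ[ℝ] ℝ where
  toFun σ := ∑ x, F x * M.trajectoryProb N σ x
  map_add' σ τ := by
    simp only [trajectoryProb, trajectoryState_add, trace_add, Complex.add_re, mul_add,
      Finset.sum_add_distrib]
  map_smul' c σ := by
    simp only [trajectoryProb, trajectoryState_smul, trace_smul, Complex.smul_re, smul_eq_mul,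
      Finset.mul_sum, mul_left_comm, RingHom.id_apply]

section Mean

variable {K : ℕ}

theorem trajectoryMean_apply (F : (Fin K → ι) → ℝ) (σ : Matrix d d ℂ) :
    M.trajectoryMean N F σ = ∑ x, F x * M.trajectoryProb N σ x := rfl

theorem trajectoryMean_add (F G : (Fin K → ι) → ℝ) (σ : Matrix d d ℂ) :
    M.trajectoryMean N (fun x => F x + G x) σ =
      M.trajectoryMean N F σ + M.trajectoryMean N G σ := by
  simp only [trajectoryMean_apply, add_mul, Finset.sum_add_distrib]

theorem trajectoryMean_const_mul (c : ℝ) (F : (Fin K → ι) → ℝ) (σ : Matrix d d ℂ) :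
    M.trajectoryMean N (fun x => c * F x) σ = c * M.trajectoryMean N F σ := by
  simp only [trajectoryMean_apply, mul_assoc, Finset.mul_sum]

theorem trajectoryMean_succ (F : (Fin (K + 1) → ι) → ℝ) (σ : Matrix d d ℂ) :
    M.trajectoryMean N F σ = ∑ u, M.trajectoryMean N (fun y => F (Fin.cons u y))
      (M.channel (N (conjBy (M.kraus u) σ))) := by
  simp only [trajectoryMean_apply, ← trajectoryProb_cons]
  rw [← (Fin.consEquiv fun _ => ι).sum_comp, Fintype.sum_prod_type]
  rfl

variable {N} (hN : IsPositiveTracePreserving N)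

include hN

theorem trace_channel_apply (X : Matrix d d ℂ) : (M.channel (N X)).trace = X.trace :=
  (M.isPositiveTracePreserving_channel.mul hN).trace_apply X

theorem trajectoryMean_const (c : ℝ) (σ : Matrix d d ℂ) :
    M.trajectoryMean N (fun _ : Fin K → ι => c) σ = c * σ.trace.re := by
  induction K generalizing σ with
  | zero => simp [trajectoryMean_apply, trajectoryProb, trajectoryState]
  | succ K ih =>
    simp only [trajectoryMean_succ, ih, M.trace_channel_apply hN, ← Finset.mul_sum,
      sum_trace_conjBy_re]

theorem trajectoryMean_mono {σ : Matrix d d ℂ} (hσ : σ.PosSemidef) {F G : (Fin K → ι) → ℝ}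
    (hFG : ∀ x, F x ≤ G x) : M.trajectoryMean N F σ ≤ M.trajectoryMean N G σ :=
  Finset.sum_le_sum fun x _ =>
    mul_le_mul_of_nonneg_right (hFG x) (M.trajectoryProb_nonneg hN hσ x)

theorem trajectoryMean_le_add_traceNorm {σ τ : Matrix d d ℂ} (hστ : (σ - τ).IsHermitian)
    {F : (Fin K → ι) → ℝ} (hF₀ : ∀ x, 0 ≤ F x) (hF₁ : ∀ x, F x ≤ 1) :
    M.trajectoryMean N F σ ≤ M.trajectoryMean N F τ + traceNorm (σ - τ) := by
  obtain ⟨B, C, hB, hC, hBC, htr⟩ := exists_posSemidef_sub hστ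
  rw [← sub_le_iff_le_add', ← map_sub, hBC, map_sub, ← hBC]
  have hmeanB : M.trajectoryMean N F B ≤ 1 * B.trace.re :=
    (M.trajectoryMean_mono hN hB hF₁).trans_eq (M.trajectoryMean_const hN 1 B)
  have hmeanC : 0 * C.trace.re ≤ M.trajectoryMean N F C :=
    (M.trajectoryMean_const hN 0 C).symm.trans_le (M.trajectoryMean_mono hN hC hF₀)
  linarith

end Mean

end Trajectories

/-! ### Moments of the sum of the outcomes -/

/-- The sum of the centred outcomes along a trajectory. -/
def centredSum {K : ℕ} (x : Fin K → ι) : ℝ :=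
  ∑ t, (M.outcome (x t) - M.expectation ρ)

theorem centredSum_cons {K : ℕ} (u : ι) (y : Fin K → ι) :
    M.centredSum ρ (Fin.cons u y : Fin (K + 1) → ι) =
      (M.outcome u - M.expectation ρ) + M.centredSum ρ y := by
  simp only [centredSum, Fin.sum_univ_succ, Fin.cons_zero, Fin.cons_succ]

theorem centredSum_eq_mul {K : ℕ} (hK : K ≠ 0) (x : Fin K → ι) :
    M.centredSum ρ x = K * (M.empiricalAverage x - M.expectation ρ) := by
  rw [centredSum, Finset.sum_sub_distrib, empiricalAverage]
  field_simp
  simp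

variable {ρ} {N : SuperOp d} (hN : IsPositiveTracePreserving N)

include hN

variable (ρ) in
theorem trajectoryMean_centredSum (K : ℕ) (σ : Matrix d d ℂ) :
    M.trajectoryMean N (M.centredSum ρ (K := K)) σ =
      ∑ j ∈ Finset.range K, (M.hat ρ (((M.channel * N * M.channel) ^ j) σ)).trace.re := by
  induction K generalizing σ with
  | zero => simp [trajectoryMean_apply, centredSum]
  | succ K ih =>
    have hround : ∑ u, M.channel (N (conjBy (M.kraus u) σ)) =
        (M.channel * N * M.channel) σ := by
      rw [← map_sum, ← map_sum, ← channel_apply]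
      rfl
    simp only [trajectoryMean_succ, centredSum_cons, trajectoryMean_add,
      M.trajectoryMean_const hN, M.trace_channel_apply hN]
    rw [Finset.sum_add_distrib, ← trace_hat_re, ← map_sum, hround, ih, Finset.sum_range_succ',
      add_comm]
    rfl

variable (hNρ : N ρ = ρ) (hMρ : M.channel ρ = ρ)

include hNρ hMρ

theorem trajectoryMean_centredSum_sq_succ (K : ℕ) :
    M.trajectoryMean N (fun x : Fin (K + 1) → ι => M.centredSum ρ x ^ 2) ρ =
      M.variance ρ + 2 * ∑ j ∈ Finset.range K, M.lagCovariance N ρ j +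
        M.trajectoryMean N (fun x : Fin K → ι => M.centredSum ρ x ^ 2) ρ := by
  let f (u : ι) : ℝ := M.outcome u - M.expectation ρ
  let σ (u : ι) : Matrix d d ℂ := M.channel (N (conjBy (M.kraus u) ρ))
  have hsum : ∑ u, σ u = ρ := by
    rw [← map_sum, ← map_sum, ← channel_apply, hMρ, hNρ, hMρ]
  have hweighted : ∑ u, f u • σ u = (M.channel * N) (M.hat ρ ρ) := by
    simp only [hat_apply, map_sum, LinearMap.map_smul_of_tower]
    rfl
  have hcross : ∑ u, f u * M.trajectoryMean N (M.centredSum ρ (K := K)) (σ u) =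
      ∑ j ∈ Finset.range K, M.lagCovariance N ρ j := by
    simp only [← smul_eq_mul, ← map_smul, ← map_sum]
    rw [hweighted, M.trajectoryMean_centredSum ρ hN]
    rfl
  calc
    M.trajectoryMean N (fun x : Fin (K + 1) → ι => M.centredSum ρ x ^ 2) ρ =
        ∑ u, (f u ^ 2 * (σ u).trace.re +
          2 * (f u * M.trajectoryMean N (M.centredSum ρ (K := K)) (σ u)) +
          M.trajectoryMean N (fun x : Fin K → ι => M.centredSum ρ x ^ 2) (σ u)) := by
      simp only [trajectoryMean_succ, centredSum_cons, add_sq, trajectoryMean_add, mul_assoc,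
        trajectoryMean_const_mul, M.trajectoryMean_const hN, f, σ]
    _ = _ := by
      rw [Finset.sum_add_distrib, Finset.sum_add_distrib, ← Finset.mul_sum, hcross, ← map_sum,
        hsum, variance_eq]
      simp only [M.trace_channel_apply hN, f, σ]

theorem trajectoryMean_centredSum_sq (K : ℕ) :
    M.trajectoryMean N (fun x : Fin K → ι => M.centredSum ρ x ^ 2) ρ =
      K * M.variance ρ +
        2 * ∑ k ∈ Finset.range K, ∑ j ∈ Finset.range k, M.lagCovariance N ρ j := by
  induction K with
  | zero => simp [trajectoryMean_apply, centredSum]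
  | succ K ih =>
    rw [M.trajectoryMean_centredSum_sq_succ hN hNρ hMρ, ih, Finset.sum_range_succ]
    push_cast
    ring

omit hN hNρ hMρ

/-! ### Deviation probabilities -/

open Classical in
theorem deviationProb_eq_trajectoryMean (N : SuperOp d) (σ : Matrix d d ℂ) (T K : ℕ) (v ε : ℝ) :
    M.deviationProb N σ T K v ε = M.trajectoryMean N
      (fun x : Fin K → ι => if ε ≤ |M.empiricalAverage x - v| then 1 else 0) ((N ^ T) σ) := by
  simp only [deviationProb, Finset.sum_filter, trajectoryMean_apply, boole_mul]

theorem deviationProb_zero_le_trajectoryMean_div (hN : IsPositiveTracePreserving N)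
    (hρ : ρ.PosSemidef) {K : ℕ} (hK : K ≠ 0) {ε : ℝ} (hε : 0 < ε) :
    M.deviationProb N ρ 0 K (M.expectation ρ) ε ≤
      M.trajectoryMean N (fun x : Fin K → ι => M.centredSum ρ x ^ 2) ρ / (K * ε) ^ 2 := by
  classical
  have hKε : 0 < (K * ε) ^ 2 := by positivity
  rw [deviationProb_eq_trajectoryMean, div_eq_inv_mul, ← trajectoryMean_const_mul]
  refine M.trajectoryMean_mono hN hρ fun x => ?_
  split_ifs with hx
  · rw [inv_mul_eq_div, one_le_div hKε, M.centredSum_eq_mul ρ hK, mul_pow, mul_pow,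
      ← sq_abs (_ - _)]
    gcongr
  · positivity

theorem deviationProb_le_add_traceNorm (hN : IsPositiveTracePreserving N) {σ : Matrix d d ℂ}
    {T : ℕ} (hσ : ((N ^ T) σ - ρ).IsHermitian) (K : ℕ) (v ε : ℝ) :
    M.deviationProb N σ T K v ε ≤ M.deviationProb N ρ 0 K v ε + traceNorm ((N ^ T) σ - ρ) := by
  classical
  rw [deviationProb_eq_trajectoryMean, deviationProb_eq_trajectoryMean]
  exact M.trajectoryMean_le_add_traceNorm hN hσ (fun x => by positivity)
    fun x => by split_ifs <;> simp

section Stationary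

variable (hρ : ρ.PosDef) {s : ℝ} (hM : DetailedBalance s ρ M.channel)
  (hMhat : DetailedBalance s ρ (M.hat ρ))

include hρ hM hMhat in
theorem variance_add_two_mul_covariance_div_le {g ε η : ℝ} (hg : 0 < g) (hε : 0 < ε) (hη : 0 < η)
    {K : ℕ} (hK : 2 * M.variance ρ / (ε ^ 2 * η) *
      (1 / g * (M.covariance ρ / M.variance ρ) + 1 / 2) ≤ K) :
    M.variance ρ + 2 * (M.covariance ρ / g) ≤ K * (ε ^ 2 * η) := by
  rcases (M.variance_nonneg hρ.posSemidef).eq_or_lt' with hV | hV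
  · have hle := M.covariance_le_variance hρ.posSemidef
      (hM.apply_self hρ M.isPositiveTracePreserving_channel)
    have hcov : M.covariance ρ = 0 := (hle.trans_eq hV).antisymm (M.covariance_nonneg hρ hMhat)
    rw [hV, hcov, zero_div, mul_zero, add_zero]
    positivity
  · rw [div_mul_eq_mul_div, div_le_iff₀ (by positivity)] at hK
    refine le_of_eq_of_le ?_ hK
    field_simp
    ring

variable (hρ' : IsState ρ) {a : ℝ} (ha : 0 ≤ a) (ha' : a < 1)
  (hNa : ContractsOn (discriminant hρ s N) (symmetrizedTraceless hρ s) a)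

include hN hNρ hρ' ha ha' hNa hM hMhat

theorem trajectoryMean_centredSum_sq_le (K : ℕ) :
    M.trajectoryMean N (fun x : Fin K → ι => M.centredSum ρ x ^ 2) ρ ≤
      K * (M.variance ρ + 2 * (M.covariance ρ / (1 - a))) := by
  rw [M.trajectoryMean_centredSum_sq hN hNρ
    (hM.apply_self hρ M.isPositiveTracePreserving_channel), mul_add, mul_left_comm]
  gcongr
  simpa using Finset.sum_le_card_nsmul (Finset.range K) _ _ fun k _ =>
    M.sum_lagCovariance_le hρ hρ' ha ha' hNa hM hMhat k

theorem deviationProb_zero_le {ε η : ℝ} (hε : 0 < ε) (hη : 0 < η) {K : ℕ} (hK₀ : K ≠ 0)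
    (hK : 2 * M.variance ρ / (ε ^ 2 * η) *
      (1 / (1 - a) * (M.covariance ρ / M.variance ρ) + 1 / 2) ≤ K) :
    M.deviationProb N ρ 0 K (M.expectation ρ) ε ≤ η := by
  refine (M.deviationProb_zero_le_trajectoryMean_div hN hρ.posSemidef hK₀ hε).trans ?_
  rw [div_le_iff₀ (by positivity)]
  calc
    M.trajectoryMean N (fun x : Fin K → ι => M.centredSum ρ x ^ 2) ρ
        ≤ K * (M.variance ρ + 2 * (M.covariance ρ / (1 - a))) :=
      M.trajectoryMean_centredSum_sq_le hN hNρ hρ hM hMhat hρ' ha ha' hNa K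
    _ ≤ K * (K * (ε ^ 2 * η)) := by
      gcongr
      exact M.variance_add_two_mul_covariance_div_le hρ hM hMhat (sub_pos.2 ha') hε hη hK
    _ = η * (K * ε) ^ 2 := by ring

end Stationary

end Measurement

theorem IsState.posDef_gibbs {H : Matrix d d ℂ} {β : ℝ} (h : IsState (gibbs H β)) :
    (gibbs H β).PosDef := by
  have hne : (NormedSpace.exp (-(β : ℂ) • H)).trace⁻¹ ≠ 0 := fun h₀ => by
    have htrace := h.2
    rw [gibbs, h₀, zero_smul, trace_zero] at htrace
    exact zero_ne_one htrace
  exact h.1.posDef_iff_isUnit.2 ((isUnit_exp _).smul (Units.mk0 _ hne))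

end

end SingleTrajectory

open SingleTrajectory in
open scoped ComplexOrder in
theorem theorem5p3_general {d ι : Type*} [Fintype d] [DecidableEq d] [Fintype ι]
    {r : Matrix d d ℂ} (hr : r.PosDef) {s : ℝ} {N : SuperOp d} {M : Measurement d ι}
    (hN : IsPositiveTracePreserving N) (hNdb : DetailedBalance s r N)
    (hMdb : DetailedBalance s r M.channel) (hNfix : UniqueFixedState N r)
    (hNspec : spectrum ℂ N ⊆ (fun x : ℝ => (x : ℂ)) '' Set.Icc (0 : ℝ) 1)
    (hMhat : DetailedBalance s r (M.hat r)) {ρ : Matrix d d ℂ} (hρ : IsState ρ)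
    {ε η : ℝ} (hε : 0 < ε) (hη : 0 < η) {K : ℕ} (hK1 : 1 ≤ K)
    (hK : 2 * M.variance r / (ε ^ 2 * η) *
      (1 / gap N * (M.covariance r / M.variance r) + 1 / 2) ≤ K) :
    M.deviationProb N ρ (mixingTime N r η) K (M.expectation r) ε ≤ 2 * η := by
  have hrate₀ : 0 ≤ 1 - gap N := sub_nonneg.2 (gap_le_one hNspec)
  have hrate₁ : 1 - gap N < 1 := sub_lt_self 1 (gap_pos hNspec)
  have hcontract := contractsOn_discriminant_one_sub_gap hNspec hr hN hNdb hNfix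
  have hstationary : M.deviationProb N r 0 K (M.expectation r) ε ≤ η :=
    M.deviationProb_zero_le hN hNfix.2.1 hr hMdb hMhat hNfix.1 hrate₀ hrate₁ hcontract hε hη
      (Nat.one_le_iff_ne_zero.1 hK1) (by rwa [sub_sub_cancel])
  have hburn : traceNorm ((N ^ mixingTime N r η) ρ - r) ≤ η :=
    traceNorm_mixingTime_le hr hNfix.1 hN hNfix.2.1 hrate₀ hrate₁ hcontract hη hρ
  have hherm : ((N ^ mixingTime N r η) ρ - r).IsHermitian :=
    ((hN.pow _).isState_apply hρ).1.1.sub hr.1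
  calc
    M.deviationProb N ρ (mixingTime N r η) K (M.expectation r) ε
        ≤ M.deviationProb N r 0 K (M.expectation r) ε +
          traceNorm ((N ^ mixingTime N r η) ρ - r) :=
      M.deviationProb_le_add_traceNorm hN hherm K _ ε
    _ ≤ 2 * η := by linarith

theorem theorem5p3 {d ι : Type*} [Fintype d] [DecidableEq d] [Fintype ι]
    (H : Matrix d d ℂ) (hH : H.IsHermitian) (β : ℝ) (s : ℝ) (hs : s ∈ Set.Icc (0 : ℝ) 1)
    (N : SingleTrajectory.SuperOp d) (M : SingleTrajectory.Measurement d ι)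
    (hN : SingleTrajectory.IsChannel N)
    (hNdb : SingleTrajectory.DetailedBalance s (SingleTrajectory.gibbs H β) N)
    (hMdb : SingleTrajectory.DetailedBalance s (SingleTrajectory.gibbs H β) M.channel)
    (hNfix : SingleTrajectory.UniqueFixedState N (SingleTrajectory.gibbs H β))
    (hNspec : spectrum ℂ N ⊆ (fun x : ℝ => (x : ℂ)) '' Set.Icc (0 : ℝ) 1)
    (hMhat : SingleTrajectory.DetailedBalance s (SingleTrajectory.gibbs H β)
      (M.hat (SingleTrajectory.gibbs H β)))
    (ρ : Matrix d d ℂ) (hρ : SingleTrajectory.IsState ρ)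
    (ε η : ℝ) (hε : 0 < ε) (hη : 0 < η) (K : ℕ) (hK1 : 1 ≤ K)
    (hK : 2 * M.variance (SingleTrajectory.gibbs H β) / (ε ^ 2 * η) *
        (1 / SingleTrajectory.gap N *
          (M.covariance (SingleTrajectory.gibbs H β) / M.variance (SingleTrajectory.gibbs H β))
          + 1 / 2) ≤ (K : ℝ)) :
    M.deviationProb N ρ
      (SingleTrajectory.mixingTime N (SingleTrajectory.gibbs H β) η) K
      (M.expectation (SingleTrajectory.gibbs H β)) ε ≤ 2 * η :=
  theorem5p3_general hNfix.1.posDef_gibbs hN.isPositiveTracePreserving hNdb hMdb hNfix hNspec hMhat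
    hρ hε hη hK1 hK
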